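/- For $N\ge 0$ let $T$ be the dyadic tree of depth $N$: its nodes are the dyadic subintervals of $[0,1]$ of length $2^{-k}$, $0\le k\le N$. Let $T^2=T\times T$ be the bi-tree; each node $\alpha\in T^2$ is identified with its dyadic rectangle $R_\alpha\subset[0,1]^2$, and $\alpha\le\beta$ means $R_\alpha\subset R_\beta$. Let $\partial T^2$ be the set of nodes that are squares of side-length $2^{-N}$. A measure $\mu$ on $\partial T^2$ is given by masses $0\le\mu(\omega)<\infty$, $\omega\in\partial T^2$, extended by $\mu(\alpha)=0$ for $\alpha\in T^2\setminus\partial T^2$. Put $\mu(E)=\sum_{\omega\in E}\mu(\omega)$ for $E\subset\partial T^2$ and $\mu(R_\alpha)=\sum_{\omega\in\partial T^2,\ \omega\le\alpha}\mu(\omega)$; let $\mu|E$ be the restriction of $\mu$ to $E$. For $E\subset\partial T^2$ let $U_E=\bigcup_{\omega\in E}R_\omega$ and let $\mathcal R_E$ be the set of all dyadic rectangles $R=R_\alpha$, $\alpha\in T^2$, with $R\subset U_E$. For functions on $T^2$ let $$\mathbb I\varphi(\alpha)=\sum_{\beta\ge\alpha}\varphi(\beta),\qquad \mathbb I^*\psi(\alpha)=\sum_{\beta\le\alpha}\psi(\beta).$$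 **Theorem.** For a measure $\mu$ on $\partial T^2$ and a constant $C\ge0$ consider the conditions 1. ($\mu$ is $C$-Carleson) $\displaystyle\sum_{R\in\mathcal R_E}\mu(R)^2\le C\,\mu(E)$ for every $E\subset\partial T^2$; 2. ($\mu$ is hereditary Carleson with constant $C$) $\mu|E$ is $C$-Carleson for every $E\subset\partial T^2$; 3. (embedding) $\displaystyle\sum_{\omega\in\partial T^2}|\mathbb I\varphi(\omega)|^2\mu(\omega)\le C\sum_{\alpha\in T^2}|\varphi(\alpha)|^2$ for every $\varphi:T^2\to\mathbb R$; 4. (second embedding) $\displaystyle\sum_{\alpha\in T^2}|\mathbb I^*(\psi\mu)(\alpha)|^2\le C\sum_{\omega\in\partial T^2}|\psi(\omega)|^2\mu(\omega)$ for every $\psi:T^2\to\mathbb R$. These conditions are equivalent, with constants independent of the depth: there is an absolute constant $K>0$ such that, for every $N$, every measure $\mu$ on $\partial T^2$ and every $C\ge0$, if one of the four conditions holds with constant $C$, then each of the four holds with constant $KC$. Moreover, (3) holds with constant $C$ if and only if (4) holds with the same constant $C$. -/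

import Mathlib

open Finset

/-- The dyadic tree of depth `N`: a node is a generation `k ∈ {0, …, N}` together with a position
`j ∈ {0, …, 2 ^ k - 1}`. -/
def DyadicTree (N : ℕ) : Type := Σ k : Fin (N + 1), Fin (2 ^ (k : ℕ))

namespace DyadicTree

instance (N : ℕ) : Fintype (DyadicTree N) :=
  inferInstanceAs (Fintype (Σ k : Fin (N + 1), Fin (2 ^ (k : ℕ))))

instance (N : ℕ) : DecidableEq (DyadicTree N) :=
  inferInstanceAs (DecidableEq (Σ k : Fin (N + 1), Fin (2 ^ (k : ℕ))))

variable {N : ℕ}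

/-- The generation of a node; the root has generation `0`, the leaves have generation `N`. -/
def gen (I : DyadicTree N) : ℕ := I.1

/-- The position of a node within its generation. -/
def pos (I : DyadicTree N) : ℕ := I.2

/-- The dyadic subinterval `[j / 2 ^ k, (j + 1) / 2 ^ k]` of `[0, 1]` attached to a node. -/
noncomputable def interval (I : DyadicTree N) : Set ℝ :=
  Set.Icc ((I.pos : ℝ) / 2 ^ I.gen) (((I.pos : ℝ) + 1) / 2 ^ I.gen)

end DyadicTree

/-- The bi-tree `T² = T × T`, where `T` is the dyadic tree of depth `N`. -/
def BiTree (N : ℕ) : Type := DyadicTree N × DyadicTree N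

namespace BiTree

instance (N : ℕ) : Fintype (BiTree N) := inferInstanceAs (Fintype (DyadicTree N × DyadicTree N))

instance (N : ℕ) : DecidableEq (BiTree N) :=
  inferInstanceAs (DecidableEq (DyadicTree N × DyadicTree N))

variable {N : ℕ}

/-- The dyadic rectangle `R_α ⊆ [0, 1]²` attached to a node `α` of the bi-tree. -/
noncomputable def rect (α : BiTree N) : Set (ℝ × ℝ) := α.1.interval ×ˢ α.2.interval

/-- `α ≤ β` means `R_α ⊆ R_β`. -/
instance : LE (BiTree N) := ⟨fun α β => α.rect ⊆ β.rect⟩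

/-- The boundary `∂T²`: the nodes whose rectangle is a dyadic square of side-length `2 ^ (-N)`. -/
def boundary (N : ℕ) : Finset (BiTree N) :=
  univ.filter fun α => α.1.gen = N ∧ α.2.gen = N

/-- `U_E`, the union of the squares in `E`. -/
noncomputable def union (E : Finset (BiTree N)) : Set (ℝ × ℝ) := ⋃ ω ∈ E, ω.rect

open Classical in
/-- `𝓡_E`, the collection of all nodes (dyadic rectangles) contained in `U_E`. -/
noncomputable def rectsIn (E : Finset (BiTree N)) : Finset (BiTree N) :=
  univ.filter fun α => α.rect ⊆ union E

open Classical in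
/-- The Hardy operator `𝕀 φ (α) = ∑_{β ≥ α} φ(β)`. -/
noncomputable def hardy (φ : BiTree N → ℝ) (α : BiTree N) : ℝ :=
  ∑ β with α ≤ β, φ β

open Classical in
/-- The dual Hardy operator `𝕀* ψ (α) = ∑_{β ≤ α} ψ(β)`. -/
noncomputable def hardyDual (ψ : BiTree N → ℝ) (α : BiTree N) : ℝ :=
  ∑ β with β ≤ α, ψ β

end BiTree

/-- A (finite, nonnegative) measure on `∂T²`, given by the mass of each boundary square and viewed
as a function on `T²` that vanishes off the boundary. -/
structure BoundaryMeasure (N : ℕ) where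
  /-- The mass `μ(α)` of a node. -/
  mass : BiTree N → ℝ
  nonneg : ∀ α, 0 ≤ mass α
  eq_zero : ∀ α, α ∉ BiTree.boundary N → mass α = 0

namespace BoundaryMeasure

open BiTree

variable {N : ℕ} (μ : BoundaryMeasure N)

/-- `μ(E) = ∑_{ω ∈ E} μ(ω)`, for `E ⊆ ∂T²`. -/
noncomputable def measure (E : Finset (BiTree N)) : ℝ := ∑ ω ∈ E, μ.mass ω

open Classical in
/-- `μ(R_α)`, the total mass of the boundary squares contained in `R_α`. -/
noncomputable def rectMass (α : BiTree N) : ℝ := ∑ ω ∈ boundary N with ω ≤ α, μ.mass ω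

/-- The restriction `μ|E`. -/
noncomputable def restrict (E : Finset (BiTree N)) : BoundaryMeasure N where
  mass ω := if ω ∈ E then μ.mass ω else 0
  nonneg ω := by
    split_ifs
    · exact μ.nonneg ω
    · exact le_rfl
  eq_zero ω hω := by
    split_ifs
    · exact μ.eq_zero ω hω
    · rfl

/-- `μ` is `C`-Carleson: `∑_{R ∈ 𝓡_E} μ(R)² ≤ C μ(E)` for every `E ⊆ ∂T²`. -/
def IsCarleson (C : ℝ) : Prop :=
  ∀ E ⊆ boundary N, ∑ R ∈ rectsIn E, μ.rectMass R ^ 2 ≤ C * μ.measure E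

/-- `μ` is hereditary Carleson with constant `C`: every restriction `μ|E` is `C`-Carleson. -/
def IsHereditaryCarleson (C : ℝ) : Prop :=
  ∀ E ⊆ boundary N, (μ.restrict E).IsCarleson C

/-- `μ` is an embedding measure for the Hardy operator, with constant `C`. -/
def IsEmbedding (C : ℝ) : Prop :=
  ∀ φ : BiTree N → ℝ,
    ∑ ω ∈ boundary N, |hardy φ ω| ^ 2 * μ.mass ω ≤ C * ∑ α, |φ α| ^ 2

/-- `μ` satisfies the second embedding, with constant `C`. -/
def IsDualEmbedding (C : ℝ) : Prop :=
  ∀ ψ : BiTree N → ℝ,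
    ∑ α, |hardyDual (fun β => ψ β * μ.mass β) α| ^ 2 ≤
      C * ∑ ω ∈ boundary N, |ψ ω| ^ 2 * μ.mass ω

end BoundaryMeasure

/-! The two embeddings are dual to each other, and the second one tested on indicators gives the
hereditary Carleson condition, hence the Carleson condition. The work lies in passing from Carleson
to the second embedding. This is done on a product of two finite forests, with the restricted energy
condition as intermediate stage.

Write `V = 𝕀 𝕀* ν` for the potential of `ν`. The engine is `sum_sq_truncMass_le`: nodes where `V ≤
δ` carry little energy. Let `f` be `𝕀* ν` cut off to these nodes. Two nodes above a common one are
either nested or crossing. In the square of `𝕀 f` the nested pairs cost at most `δ 𝕀 f`, and the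
crossing pairs add up to `𝕀 (𝕀₁ f · 𝕀₂ f)`, where `𝕀₁`, `𝕀₂` are the one-variable sums
(`sq_upSum_prod_le`). The product `𝕀₁ f · 𝕀₂ f` has `ℓ²` norm at most `2 δ` times that of `f`
(`sum_sq_fst_mul_snd_le`). This replaces the maximum principle.

Carleson to restricted energy: take the set `E` with the largest ratio `A` of energy to mass. Nodes
of potential at most a small multiple of `A` carry at most half of the energy. The others form a
lower set, whose mass is controlled by a weak-type bound, so Carleson applies and `A` is bounded by
a multiple of `C`.

Restricted energy to embedding: cut `ψ` into levels between powers of 16. The same engine gives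
off-diagonal decay of the mutual energies of the levels (`sum_downSum_mul_le`), and the double sum
converges geometrically. -/

/-- Any two elements with a common lower bound are comparable. -/
def IsForest (X : Type*) [Preorder X] : Prop :=
  ∀ ⦃a b c : X⦄, a ≤ b → a ≤ c → b ≤ c ∨ c ≤ b

/-! ### Hardy sums on one finite preorder or forest. -/

section PreorderSums

variable {P : Type*} [Fintype P] [Preorder P]

open Classical in
/-- The sum of `f` over the elements above `p`. -/
noncomputable def upSum (f : P → ℝ) (p : P) : ℝ := ∑ q with p ≤ q, f q

open Classical in
/-- The sum of `f` over the elements below `p`. -/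
noncomputable def downSum (f : P → ℝ) (p : P) : ℝ := ∑ q with q ≤ p, f q

theorem upSum_eq [DecidableLE P] (f : P → ℝ) (p : P) :
    upSum f p = ∑ q, if p ≤ q then f q else 0 := by
  rw [upSum, Finset.sum_filter]
  congr!

theorem downSum_eq [DecidableLE P] (f : P → ℝ) (p : P) :
    downSum f p = ∑ q, if q ≤ p then f q else 0 := by
  rw [downSum, Finset.sum_filter]
  congr!

theorem upSum_nonneg {f : P → ℝ} (hf : ∀ p, 0 ≤ f p) (p : P) : 0 ≤ upSum f p :=
  Finset.sum_nonneg fun q _ => hf q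

theorem downSum_nonneg {f : P → ℝ} (hf : ∀ p, 0 ≤ f p) (p : P) : 0 ≤ downSum f p :=
  Finset.sum_nonneg fun q _ => hf q

theorem upSum_mono {f g : P → ℝ} (h : ∀ p, f p ≤ g p) (p : P) : upSum f p ≤ upSum g p :=
  Finset.sum_le_sum fun q _ => h q

theorem downSum_mono {f g : P → ℝ} (h : ∀ p, f p ≤ g p) (p : P) : downSum f p ≤ downSum g p :=
  Finset.sum_le_sum fun q _ => h q

theorem upSum_const_mul (c : ℝ) (f : P → ℝ) (p : P) :
    upSum (fun q => c * f q) p = c * upSum f p :=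
  (Finset.mul_sum _ _ _).symm

theorem upSum_antitone {f : P → ℝ} (hf : ∀ p, 0 ≤ f p) {p q : P} (h : p ≤ q) :
    upSum f q ≤ upSum f p := by
  classical
  refine Finset.sum_le_sum_of_subset_of_nonneg (fun r hr => ?_) fun r _ _ => hf r
  simp only [mem_filter, mem_univ, true_and] at hr ⊢
  exact h.trans hr

theorem sum_upSum_mul (f g : P → ℝ) : ∑ p, upSum f p * g p = ∑ p, f p * downSum g p := by
  classical
  simp only [upSum_eq, downSum_eq, Finset.sum_mul, Finset.mul_sum]
  rw [Finset.sum_comm]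
  refine Finset.sum_congr rfl fun p _ => Finset.sum_congr rfl fun q _ => ?_
  split_ifs <;> simp

/-- The elements above `p` are pairwise comparable, so every pair in the expanded square is ordered;
the factor 2 accounts for the two orders. -/
theorem sq_upSum_le (hP : IsForest P) {f : P → ℝ} (hf : ∀ p, 0 ≤ f p) (p : P) :
    upSum f p ^ 2 ≤ 2 * upSum (fun q => f q * upSum f q) p := by
  classical
  have key : upSum (fun q => f q * upSum f q) p =
      ∑ a, ∑ b, if p ≤ a ∧ a ≤ b then f a * f b else 0 := by
    simp only [upSum_eq, Finset.mul_sum]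
    refine Finset.sum_congr rfl fun a _ => ?_
    split_ifs with h <;> simp [h]
  have key' : upSum (fun q => f q * upSum f q) p =
      ∑ a, ∑ b, if p ≤ b ∧ b ≤ a then f b * f a else 0 := by
    rw [key, Finset.sum_comm]
  rw [two_mul]
  nth_rw 1 [key]
  rw [key', sq, upSum_eq, Finset.sum_mul_sum, ← Finset.sum_add_distrib]
  refine Finset.sum_le_sum fun a _ => ?_
  rw [← Finset.sum_add_distrib]
  refine Finset.sum_le_sum fun b _ => ?_
  have h0 := mul_nonneg (hf a) (hf b)
  have h1 := mul_nonneg (hf b) (hf a)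
  by_cases ha : p ≤ a
  · by_cases hb : p ≤ b
    · rcases hP ha hb with h | h
      · simp only [ha, hb, h, and_self, true_and, if_true]
        split_ifs <;> linarith
      · simp only [ha, hb, h, and_self, true_and, if_true]
        split_ifs <;> linarith
    · simp only [hb, if_false, mul_zero]
      split_ifs <;> linarith
  · simp only [ha, if_false, zero_mul]
    split_ifs <;> linarith

/-- If the tails of `h` along an up-set `W` of a forest are at most `δ`, then summing `h` against
the masses of the elements below loses only a factor `δ`. -/
theorem sum_mass_mul_le {Q : Type*} [Fintype Q] (hP : IsForest P) {w : Q → ℝ} (hw : ∀ q, 0 ≤ w q)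
    (s : Q → P) {W : Set P} (hW : IsUpperSet W) {h : P → ℝ} (hh : ∀ p, 0 ≤ h p) {δ : ℝ}
    (hδ : ∀ p ∈ W, upSum h p ≤ δ) [DecidablePred (· ∈ W)] [DecidableLE P] (c : P) :
    ∑ p with p ≤ c, (if p ∈ W then ∑ q with s q ≤ p, w q else 0) * h p ≤
      δ * if c ∈ W then ∑ q with s q ≤ c, w q else 0 := by
  classical
  have e1 : ∑ p with p ≤ c, (if p ∈ W then ∑ q with s q ≤ p, w q else 0) * h p =
      ∑ q, w q * ∑ p with p ≤ c ∧ p ∈ W ∧ s q ≤ p, h p := by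
    simp only [Finset.sum_filter, Finset.mul_sum]
    rw [Finset.sum_comm]
    refine Finset.sum_congr rfl fun p _ => ?_
    by_cases h1 : p ≤ c <;> by_cases h2 : p ∈ W <;> simp [h1, h2, Finset.sum_mul]
  have e2 : (δ * if c ∈ W then ∑ q with s q ≤ c, w q else 0) =
      ∑ q, w q * if c ∈ W ∧ s q ≤ c then δ else 0 := by
    by_cases h2 : c ∈ W
    · simp only [h2, if_true, Finset.sum_filter, Finset.mul_sum, true_and]
      refine Finset.sum_congr rfl fun q _ => ?_
      split_ifs <;> ring
    · simp [h2]
  rw [e1, e2]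
  refine Finset.sum_le_sum fun q _ => mul_le_mul_of_nonneg_left ?_ (hw q)
  rcases Finset.eq_empty_or_nonempty (univ.filter fun p => p ≤ c ∧ p ∈ W ∧ s q ≤ p) with he | he
  · rw [he, Finset.sum_empty]
    split_ifs with hc
    · exact (upSum_nonneg hh c).trans (hδ c hc.1)
    · exact le_rfl
  -- All these elements lie above `s q`, hence are comparable, so a minimal one is below all of them
  -- and its tail of `h` contains the whole sum.
  · obtain ⟨m, hm⟩ := Finset.exists_minimal he
    have hmem := hm.1
    simp only [mem_filter, mem_univ, true_and] at hmem
    rw [if_pos ⟨hW hmem.1 hmem.2.1, hmem.2.2.trans hmem.1⟩]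
    refine le_trans ?_ (hδ m hmem.2.1)
    refine Finset.sum_le_sum_of_subset_of_nonneg (fun p hp => ?_) fun p _ _ => hh p
    have hp' := hp
    simp only [mem_filter, mem_univ, true_and] at hp' ⊢
    rcases hP hmem.2.2 hp'.2.2 with h1 | h1
    · exact h1
    · exact hm.2 hp h1

end PreorderSums

/-! ### Products of two forests: crossing pairs and one-variable sums. -/

section Partial

variable {X Y : Type*}

/-- The partial sum of `f` over the elements above a given one in the first coordinate. -/
noncomputable def upSumFst [Fintype X] [Preorder X] (f : X × Y → ℝ) (p : X × Y) : ℝ :=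
  upSum (fun x => f (x, p.2)) p.1

/-- The partial sum of `f` over the elements above a given one in the second coordinate. -/
noncomputable def upSumSnd [Fintype Y] [Preorder Y] (f : X × Y → ℝ) (p : X × Y) : ℝ :=
  upSum (fun y => f (p.1, y)) p.2

theorem upSumFst_nonneg [Fintype X] [Preorder X] {f : X × Y → ℝ} (hf : ∀ p, 0 ≤ f p)
    (p : X × Y) : 0 ≤ upSumFst f p :=
  upSum_nonneg (fun _ => hf _) _

theorem upSumSnd_nonneg [Fintype Y] [Preorder Y] {f : X × Y → ℝ} (hf : ∀ p, 0 ≤ f p)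
    (p : X × Y) : 0 ≤ upSumSnd f p :=
  upSum_nonneg (fun _ => hf _) _

end Partial

section Product

variable {X Y : Type*} [Fintype X] [Preorder X] [Fintype Y] [Preorder Y]

theorem upSum_upSumFst (f : X × Y → ℝ) (x : X) (y : Y) :
    upSum (fun b => upSumFst f (x, b)) y = upSum f (x, y) := by
  classical
  simp only [upSumFst, upSum_eq, Fintype.sum_prod_type, Prod.mk_le_mk]
  rw [Finset.sum_comm]
  refine Finset.sum_congr rfl fun b _ => ?_
  split_ifs with h <;> simp [h]

theorem upSum_upSumSnd (f : X × Y → ℝ) (x : X) (y : Y) :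
    upSum (fun a => upSumSnd f (a, y)) x = upSum f (x, y) := by
  classical
  simp only [upSumSnd, upSum_eq, Fintype.sum_prod_type, Prod.mk_le_mk]
  refine Finset.sum_congr rfl fun b _ => ?_
  split_ifs with h <;> simp [h]

/-- A crossing pair `a`, `b` is recorded by its corner `q = (a.1, b.2)`: then `b` is a term of
`upSumFst f q` and `a` one of `upSumSnd f q`. -/
theorem upSum_fst_mul_snd (f : X × Y → ℝ) (p : X × Y) [DecidableLE X] [DecidableLE Y] :
    upSum (fun q => upSumFst f q * upSumSnd f q) p = ∑ a : X × Y, ∑ b : X × Y,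
      if (p.1 ≤ a.1 ∧ a.1 ≤ b.1) ∧ (p.2 ≤ b.2 ∧ b.2 ≤ a.2) then f a * f b else 0 := by
  classical
  have : ∀ x y, (if p ≤ (x, y) then upSumFst f (x, y) * upSumSnd f (x, y) else 0) =
      ∑ y', ∑ x', if (p.1 ≤ x ∧ x ≤ x') ∧ (p.2 ≤ y ∧ y ≤ y') then f (x, y') * f (x', y) else 0 := by
    intro x y
    by_cases h : p ≤ (x, y)
    · obtain ⟨h1, h2⟩ := Prod.le_def.1 h
      simp only at h1 h2
      simp only [h, h1, h2, true_and, if_true, upSumFst, upSumSnd, upSum_eq]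
      rw [mul_comm, Finset.sum_mul_sum]
      refine Finset.sum_congr rfl fun y' _ => Finset.sum_congr rfl fun x' _ => ?_
      by_cases h3 : x ≤ x' <;> by_cases h4 : y ≤ y' <;> simp [h3, h4]
    · rw [if_neg h]
      symm
      refine Finset.sum_eq_zero fun y' _ => Finset.sum_eq_zero fun x' _ => if_neg ?_
      exact fun h' => h ⟨h'.1.1, h'.2.1⟩
  simp only [upSum_eq, Fintype.sum_prod_type, this]
  refine Finset.sum_congr rfl fun x _ => ?_
  rw [Finset.sum_comm]
  refine Finset.sum_congr rfl fun y' _ => ?_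
  rw [Finset.sum_comm]

/-- Comparability in each coordinate leaves four cases for a pair above `p`: two nested orders and
two crossing ones. In a nested pair the sum over the larger element is a potential at a point of the
support of `f`, hence at most `δ`. -/
theorem sq_upSum_prod_le (hX : IsForest X) (hY : IsForest Y) {f : X × Y → ℝ} (hf : ∀ p, 0 ≤ f p)
    {δ : ℝ} (hδ : ∀ p, f p ≠ 0 → upSum f p ≤ δ) (p : X × Y) :
    upSum f p ^ 2 ≤ 2 * upSum (fun q => upSumFst f q * upSumSnd f q) p + 2 * (δ * upSum f p) := by
  classical
  have nested : ∑ a, ∑ b, (if p ≤ a ∧ a ≤ b then f a * f b else 0) ≤ δ * upSum f p := by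
    rw [← upSum_const_mul, upSum_eq]
    refine Finset.sum_le_sum fun a _ => ?_
    by_cases h : p ≤ a
    · simp only [h, true_and, if_true]
      have : ∑ b, (if a ≤ b then f a * f b else 0) = f a * upSum f a := by
        rw [upSum_eq, Finset.mul_sum]
        exact Finset.sum_congr rfl fun b _ => by split_ifs <;> simp
      rw [this, mul_comm]
      rcases eq_or_ne (f a) 0 with h0 | h0
      · simp [h0]
      · exact mul_le_mul_of_nonneg_right (hδ a h0) (hf a)
    · simp [h]
  have nested' : ∑ a, ∑ b, (if p ≤ b ∧ b ≤ a then f a * f b else 0) ≤ δ * upSum f p := by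
    rw [Finset.sum_comm]
    simpa only [mul_comm] using nested
  have cross := upSum_fst_mul_snd f p
  have cross' := cross
  rw [Finset.sum_comm] at cross'
  have main : upSum f p ^ 2 ≤
      (∑ a, ∑ b, (if p ≤ a ∧ a ≤ b then f a * f b else 0)) +
      (∑ a, ∑ b, (if p ≤ b ∧ b ≤ a then f a * f b else 0)) +
      (∑ a : X × Y, ∑ b : X × Y,
        if (p.1 ≤ a.1 ∧ a.1 ≤ b.1) ∧ (p.2 ≤ b.2 ∧ b.2 ≤ a.2) then f a * f b else 0) +
      (∑ a : X × Y, ∑ b : X × Y,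
        if (p.1 ≤ b.1 ∧ b.1 ≤ a.1) ∧ (p.2 ≤ a.2 ∧ a.2 ≤ b.2) then f b * f a else 0) := by
    rw [sq, upSum_eq, Finset.sum_mul_sum]
    simp only [← Finset.sum_add_distrib]
    refine Finset.sum_le_sum fun a _ => Finset.sum_le_sum fun b _ => ?_
    have h0 := mul_nonneg (hf a) (hf b)
    rw [mul_comm (f b) (f a)]
    have i1 : ∀ (Q : Prop) [Decidable Q], 0 ≤ (if Q then f a * f b else 0) := by
      intro Q _
      split_ifs <;> simp [h0]
    by_cases ha : p ≤ a
    · by_cases hb : p ≤ b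
      · rw [if_pos ha, if_pos hb]
        have ha' := Prod.le_def.1 ha
        have hb' := Prod.le_def.1 hb
        rcases hX ha'.1 hb'.1 with h | h <;> rcases hY ha'.2 hb'.2 with h' | h'
        · rw [if_pos (⟨ha, h, h'⟩ : p ≤ a ∧ a ≤ b)]
          linarith [i1 (p ≤ b ∧ b ≤ a), i1 ((p.1 ≤ a.1 ∧ a.1 ≤ b.1) ∧ (p.2 ≤ b.2 ∧ b.2 ≤ a.2)),
            i1 ((p.1 ≤ b.1 ∧ b.1 ≤ a.1) ∧ (p.2 ≤ a.2 ∧ a.2 ≤ b.2))]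
        · rw [if_pos (⟨⟨ha'.1, h⟩, hb'.2, h'⟩ :
            (p.1 ≤ a.1 ∧ a.1 ≤ b.1) ∧ (p.2 ≤ b.2 ∧ b.2 ≤ a.2))]
          linarith [i1 (p ≤ b ∧ b ≤ a), i1 (p ≤ a ∧ a ≤ b),
            i1 ((p.1 ≤ b.1 ∧ b.1 ≤ a.1) ∧ (p.2 ≤ a.2 ∧ a.2 ≤ b.2))]
        · rw [if_pos (⟨⟨hb'.1, h⟩, ha'.2, h'⟩ :
            (p.1 ≤ b.1 ∧ b.1 ≤ a.1) ∧ (p.2 ≤ a.2 ∧ a.2 ≤ b.2))]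
          linarith [i1 (p ≤ b ∧ b ≤ a), i1 (p ≤ a ∧ a ≤ b),
            i1 ((p.1 ≤ a.1 ∧ a.1 ≤ b.1) ∧ (p.2 ≤ b.2 ∧ b.2 ≤ a.2))]
        · rw [if_pos (⟨hb, h, h'⟩ : p ≤ b ∧ b ≤ a)]
          linarith [i1 (p ≤ a ∧ a ≤ b), i1 ((p.1 ≤ a.1 ∧ a.1 ≤ b.1) ∧ (p.2 ≤ b.2 ∧ b.2 ≤ a.2)),
            i1 ((p.1 ≤ b.1 ∧ b.1 ≤ a.1) ∧ (p.2 ≤ a.2 ∧ a.2 ≤ b.2))]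
      · rw [if_neg hb, mul_zero]
        linarith [i1 (p ≤ a ∧ a ≤ b), i1 (p ≤ b ∧ b ≤ a),
          i1 ((p.1 ≤ a.1 ∧ a.1 ≤ b.1) ∧ (p.2 ≤ b.2 ∧ b.2 ≤ a.2)),
          i1 ((p.1 ≤ b.1 ∧ b.1 ≤ a.1) ∧ (p.2 ≤ a.2 ∧ a.2 ≤ b.2))]
    · rw [if_neg ha, zero_mul]
      linarith [i1 (p ≤ a ∧ a ≤ b), i1 (p ≤ b ∧ b ≤ a),
        i1 ((p.1 ≤ a.1 ∧ a.1 ≤ b.1) ∧ (p.2 ≤ b.2 ∧ b.2 ≤ a.2)),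
        i1 ((p.1 ≤ b.1 ∧ b.1 ≤ a.1) ∧ (p.2 ≤ a.2 ∧ a.2 ≤ b.2))]
  linarith [nested, nested', main, cross, cross']

open Classical in
/-- The masses `μ(R_p)` of the elements `p` of `U`. -/
noncomputable def truncMass (μ : X × Y → ℝ) (U : Set (X × Y)) (p : X × Y) : ℝ :=
  if p ∈ U then downSum μ p else 0

theorem truncMass_nonneg {μ : X × Y → ℝ} (hμ : ∀ p, 0 ≤ μ p) (U : Set (X × Y)) (p : X × Y) :
    0 ≤ truncMass μ U p := by
  unfold truncMass
  split_ifs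
  · exact downSum_nonneg hμ p
  · exact le_rfl

/-- An instance of `sum_mass_mul_le` on the fibre over `b`, for the part of `μ` with first
coordinate below `b`: the tails of `upSumFst` along the fibre are full potentials, hence at most `δ`
on `U`. -/
theorem sum_truncMass_mul_upSumFst_le (hY : IsForest Y) {μ : X × Y → ℝ} (hμ : ∀ p, 0 ≤ μ p)
    {U : Set (X × Y)} (hU : IsUpperSet U) {δ : ℝ} (hδ : ∀ p ∈ U, upSum (truncMass μ U) p ≤ δ)
    [DecidableLE Y] (b : X) (c : Y) :
    ∑ y with y ≤ c, truncMass μ U (b, y) * upSumFst (truncMass μ U) (b, y) ≤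
      δ * truncMass μ U (b, c) := by
  classical
  have hf := truncMass_nonneg hμ U
  have hmass : ∀ y, truncMass μ U (b, y) = if y ∈ {y | (b, y) ∈ U} then
      ∑ q : X × Y with q.2 ≤ y, (if q.1 ≤ b then μ q else 0) else 0 := by
    intro y
    simp only [truncMass, downSum_eq, Set.mem_ofPred_eq, Finset.sum_filter]
    refine if_congr Iff.rfl (Finset.sum_congr rfl fun q _ => ?_) rfl
    rw [← ite_and]
    exact if_congr (by rw [Prod.le_def, and_comm]) rfl rfl
  simp only [hmass]
  refine sum_mass_mul_le hY (fun q => ?_) Prod.snd (W := {y | (b, y) ∈ U}) ?_ ?_ ?_ c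
  · split_ifs
    · exact hμ q
    · exact le_rfl
  · exact fun y y' h hy => hU (Prod.mk_le_mk.2 ⟨le_rfl, h⟩) hy
  · exact fun y => upSumFst_nonneg hf _
  · intro y hy
    rw [upSum_upSumFst]
    exact hδ _ hy

theorem sum_truncMass_mul_upSumSnd_le (hX : IsForest X) {μ : X × Y → ℝ} (hμ : ∀ p, 0 ≤ μ p)
    {U : Set (X × Y)} (hU : IsUpperSet U) {δ : ℝ} (hδ : ∀ p ∈ U, upSum (truncMass μ U) p ≤ δ)
    [DecidableLE X] (b : X) (c : Y) :
    ∑ x with x ≤ b, truncMass μ U (x, c) * upSumSnd (truncMass μ U) (x, c) ≤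
      δ * truncMass μ U (b, c) := by
  classical
  have hf := truncMass_nonneg hμ U
  have hmass : ∀ x, truncMass μ U (x, c) = if x ∈ {x | (x, c) ∈ U} then
      ∑ q : X × Y with q.1 ≤ x, (if q.2 ≤ c then μ q else 0) else 0 := by
    intro x
    simp only [truncMass, downSum_eq, Set.mem_ofPred_eq, Finset.sum_filter]
    refine if_congr Iff.rfl (Finset.sum_congr rfl fun q _ => ?_) rfl
    rw [← ite_and]
    exact if_congr (by rw [Prod.le_def]) rfl rfl
  simp only [hmass]
  refine sum_mass_mul_le hX (fun q => ?_) Prod.fst (W := {x | (x, c) ∈ U}) ?_ ?_ ?_ b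
  · split_ifs
    · exact hμ q
    · exact le_rfl
  · exact fun y y' h hy => hU (Prod.mk_le_mk.2 ⟨h, le_rfl⟩) hy
  · exact fun y => upSumSnd_nonneg hf _
  · intro y hy
    rw [upSum_upSumSnd]
    exact hδ _ hy

/-- The square of each one-variable sum is linearized by `sq_upSum_le`. After exchanging the order
of summation, the inner sum at `q` factors into two fibre sums, each at most `δ` times the truncated
mass at `q`. -/
theorem sum_sq_fst_mul_snd_le (hX : IsForest X) (hY : IsForest Y) {μ : X × Y → ℝ}
    (hμ : ∀ p, 0 ≤ μ p) {U : Set (X × Y)} (hU : IsUpperSet U) {δ : ℝ}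
    (hδ : ∀ p ∈ U, upSum (truncMass μ U) p ≤ δ) :
    ∑ p, (upSumFst (truncMass μ U) p * upSumSnd (truncMass μ U) p) ^ 2 ≤
      4 * δ ^ 2 * ∑ p, truncMass μ U p ^ 2 := by
  classical
  set f := truncMass μ U with hfdef
  have hf : ∀ p, 0 ≤ f p := truncMass_nonneg hμ U
  have step : ∀ p : X × Y, (upSumFst f p * upSumSnd f p) ^ 2 ≤
      4 * ∑ q : X × Y, if p ≤ q then
        (f (q.1, p.2) * upSumFst f (q.1, p.2)) * (f (p.1, q.2) * upSumSnd f (p.1, q.2)) else 0 := by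
    rintro ⟨x, y⟩
    have h1 := sq_upSum_le hX (f := fun a => f (a, y)) (fun _ => hf _) x
    have h2 := sq_upSum_le hY (f := fun a => f (x, a)) (fun _ => hf _) y
    rw [mul_pow]
    refine (mul_le_mul h1 h2 (sq_nonneg _) ?_).trans (le_of_eq ?_)
    · exact mul_nonneg zero_le_two
        (upSum_nonneg (fun _ => mul_nonneg (hf _) (upSum_nonneg (fun _ => hf _) _)) _)
    · rw [mul_mul_mul_comm, upSum_eq, upSum_eq, Finset.sum_mul_sum, Fintype.sum_prod_type]
      norm_num
      refine Finset.sum_congr rfl fun a _ => Finset.sum_congr rfl fun b _ => ?_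
      by_cases h3 : x ≤ a <;> by_cases h4 : y ≤ b <;> simp [h3, h4, upSumFst, upSumSnd]
  calc ∑ p, (upSumFst f p * upSumSnd f p) ^ 2
      ≤ ∑ p : X × Y, 4 * ∑ q : X × Y, (if p ≤ q then
        (f (q.1, p.2) * upSumFst f (q.1, p.2)) * (f (p.1, q.2) * upSumSnd f (p.1, q.2))
          else 0) := Finset.sum_le_sum fun p _ => step p
    _ = 4 * ∑ q : X × Y, (∑ y with y ≤ q.2, f (q.1, y) * upSumFst f (q.1, y)) *
          (∑ x with x ≤ q.1, f (x, q.2) * upSumSnd f (x, q.2)) := by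
        rw [← Finset.mul_sum, Finset.sum_comm]
        congr 1
        refine Finset.sum_congr rfl fun q _ => ?_
        rw [mul_comm, Finset.sum_filter, Finset.sum_filter, Finset.sum_mul_sum,
          Fintype.sum_prod_type]
        refine Finset.sum_congr rfl fun a _ => Finset.sum_congr rfl fun b _ => ?_
        by_cases h3 : a ≤ q.1 <;> by_cases h4 : b ≤ q.2 <;> simp [Prod.le_def, h3, h4, mul_comm]
    _ ≤ 4 * ∑ q : X × Y, (δ * f q) * (δ * f q) := by
        refine mul_le_mul_of_nonneg_left (Finset.sum_le_sum fun q _ => ?_) (by norm_num)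
        have h1 := sum_truncMass_mul_upSumFst_le hY hμ hU hδ q.1 q.2
        have h2 := sum_truncMass_mul_upSumSnd_le hX hμ hU hδ q.1 q.2
        have h3 : 0 ≤ ∑ x with x ≤ q.1, f (x, q.2) * upSumSnd f (x, q.2) :=
          Finset.sum_nonneg fun x _ => mul_nonneg (hf _) (upSumSnd_nonneg hf _)
        have h4 : 0 ≤ ∑ y with y ≤ q.2, f (q.1, y) * upSumFst f (q.1, y) :=
          Finset.sum_nonneg fun x _ => mul_nonneg (hf _) (upSumFst_nonneg hf _)
        exact mul_le_mul h1 h2 h3 (h4.trans h1)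
    _ = 4 * δ ^ 2 * ∑ p, f p ^ 2 := by
        rw [mul_assoc, Finset.mul_sum (s := univ) (a := δ ^ 2)]
        congr 1
        exact Finset.sum_congr rfl fun q _ => by ring

end Product

/-! ### Masses, energies and the weak-type bound. -/

section Mass

variable {P : Type*} [Fintype P]

/-- The total mass of the restriction of `μ` to `E`. -/
noncomputable def massOn (μ : P → ℝ) (E : Set P) : ℝ := ∑ p, E.indicator μ p

theorem massOn_nonneg {μ : P → ℝ} (hμ : ∀ p, 0 ≤ μ p) (E : Set P) : 0 ≤ massOn μ E :=
  Finset.sum_nonneg fun p _ => Set.indicator_nonneg (fun p _ => hμ p) p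

theorem massOn_mono {μ : P → ℝ} (hμ : ∀ p, 0 ≤ μ p) {E F : Set P} (h : E ⊆ F) :
    massOn μ E ≤ massOn μ F :=
  Finset.sum_le_sum fun p _ => Set.indicator_le_indicator_of_subset h hμ p

end Mass

section Energy

variable {P : Type*} [Fintype P] [Preorder P]

/-- The energy `∑ (𝕀* ρ)²` of `ρ`. -/
noncomputable def energy (ρ : P → ℝ) : ℝ := ∑ p, downSum ρ p ^ 2

/-- The restricted energy condition: the energy of each restriction of `μ` is at most `A` times its
mass. -/
def RestrictedEnergy (μ : P → ℝ) (A : ℝ) : Prop :=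
  ∀ E : Set P, energy (E.indicator μ) ≤ A * massOn μ E

theorem energy_nonneg (ρ : P → ℝ) : 0 ≤ energy ρ := Finset.sum_nonneg fun _ _ => sq_nonneg _

theorem downSum_indicator_le {μ : P → ℝ} (hμ : ∀ p, 0 ≤ μ p) (E : Set P) (p : P) :
    downSum (E.indicator μ) p ≤ downSum μ p :=
  downSum_mono (fun q => Set.indicator_le_self' (fun q _ => hμ q) q) p

theorem downSum_indicator_inter {μ : P → ℝ} {G : Set P} (hG : IsLowerSet G) (F : Set P) {p : P}
    (hp : p ∈ G) : downSum ((F ∩ G).indicator μ) p = downSum (F.indicator μ) p := by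
  refine Finset.sum_congr rfl fun q hq => ?_
  have hqG : q ∈ G := hG (by simpa using hq) hp
  by_cases hF : q ∈ F
  · rw [Set.indicator_of_mem (Set.mem_inter hF hqG), Set.indicator_of_mem hF]
  · rw [Set.indicator_of_notMem (fun h => hF h.1), Set.indicator_of_notMem hF]

theorem sum_downSum_mul_le_sqrt {μ : P → ℝ} {A : ℝ} (hA : 0 ≤ A) (hH : RestrictedEnergy μ A)
    (E F : Set P) :
    ∑ p, downSum (E.indicator μ) p * downSum (F.indicator μ) p ≤
      A * (√(massOn μ E) * √(massOn μ F)) := by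
  refine (Real.sum_mul_le_sqrt_mul_sqrt _ _ _).trans ?_
  refine (mul_le_mul (Real.sqrt_le_sqrt (hH E)) (Real.sqrt_le_sqrt (hH F)) (Real.sqrt_nonneg _)
    (Real.sqrt_nonneg _)).trans (le_of_eq ?_)
  rw [Real.sqrt_mul hA, Real.sqrt_mul hA, mul_mul_mul_comm, Real.mul_self_sqrt hA]

theorem isLowerSet_lt_upSum {f : P → ℝ} (hf : ∀ p, 0 ≤ f p) (δ : ℝ) :
    IsLowerSet {p | δ < upSum f p} :=
  fun _ _ h hp => lt_of_lt_of_le hp (upSum_antitone hf h)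

/-- The weak-type estimate for the potential of `μ` restricted to `E`. -/
theorem sqrt_massOn_lt_potential_le {μ : P → ℝ} (hμ : ∀ p, 0 ≤ μ p) {A : ℝ} (hA : 0 ≤ A)
    (hH : RestrictedEnergy μ A) (E : Set P) {δ : ℝ} (hδ : 0 < δ) :
    √(massOn μ {p | δ < upSum (downSum (E.indicator μ)) p}) ≤ A / δ * √(massOn μ E) := by
  set G := {p | δ < upSum (downSum (E.indicator μ)) p} with hG
  -- Integrating the potential of `μ|E` over `G` gives the mutual energy of the two restrictions;
  -- one factor `√(massOn μ G)` then cancels.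
  have h1 : δ * massOn μ G ≤ A * (√(massOn μ E) * √(massOn μ G)) := by
    refine le_trans ?_ (sum_downSum_mul_le_sqrt hA hH E G)
    rw [← sum_upSum_mul, massOn, Finset.mul_sum]
    refine Finset.sum_le_sum fun p _ => ?_
    by_cases hp : p ∈ G
    · rw [Set.indicator_of_mem hp]
      exact mul_le_mul_of_nonneg_right (le_of_lt hp) (hμ p)
    · simp [Set.indicator_of_notMem hp]
  have hs := Real.mul_self_sqrt (massOn_nonneg hμ G)
  rcases (Real.sqrt_nonneg (massOn μ G)).eq_or_lt with h0 | h0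
  · rw [← h0]
    positivity
  · have : δ * √(massOn μ G) ≤ A * √(massOn μ E) := by
      refine le_of_mul_le_mul_right ?_ h0
      rwa [mul_assoc, mul_assoc, hs]
    rw [div_mul_eq_mul_div, le_div_iff₀ hδ]
    linarith

end Energy

/-! ### Energy at small potential, restricted energy, off-diagonal decay. -/

section ProductEnergy

variable {X Y : Type*} [Fintype X] [Preorder X] [Fintype Y] [Preorder Y]

theorem sum_upSum_truncMass_mul_le (hX : IsForest X) (hY : IsForest Y) {μ ρ : X × Y → ℝ}
    (hμ : ∀ p, 0 ≤ μ p) (hρ : ∀ p, 0 ≤ ρ p) {U : Set (X × Y)} (hU : IsUpperSet U) {δ l : ℝ}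
    (hδ0 : 0 ≤ δ) (hδ : ∀ p ∈ U, upSum (truncMass μ U) p ≤ δ) (hl : 0 < l) (hδl : 4 * δ ≤ l) :
    ∑ p, upSum (truncMass μ U) p * ρ p ≤
      l * ∑ p, ρ p + 8 * (δ / l) * (√(∑ p, truncMass μ U p ^ 2) * √(energy ρ)) := by
  set f := truncMass μ U with hfdef
  have hf : ∀ p, 0 ≤ f p := truncMass_nonneg hμ U
  set φ : X × Y → ℝ := fun q => upSumFst f q * upSumSnd f q with hφ
  have hφ0 : ∀ q, 0 ≤ φ q := fun q => mul_nonneg (upSumFst_nonneg hf q) (upSumSnd_nonneg hf q)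
  have hδ' : ∀ p, f p ≠ 0 → upSum f p ≤ δ := by
    intro p hp
    refine hδ p ?_
    by_contra h
    exact hp (if_neg h)
  -- Where `upSum f p` exceeds `l ≥ 4 δ`, the nested term is at most half of the square and is
  -- absorbed.
  have pt : ∀ p, upSum f p ≤ l + 4 / l * upSum φ p := by
    intro p
    have h1 := sq_upSum_prod_le hX hY hf hδ' p
    have h2 : 0 ≤ upSum φ p := upSum_nonneg hφ0 p
    have h3 : 0 ≤ upSum f p := upSum_nonneg hf p
    change upSum f p ^ 2 ≤ 2 * upSum φ p + 2 * (δ * upSum f p) at h1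
    rcases le_total (upSum f p) l with h | h
    · have : 0 ≤ 4 / l * upSum φ p := by positivity
      linarith
    · have h4 : l * upSum f p ≤ 4 * upSum φ p := by
        nlinarith [mul_le_mul_of_nonneg_right hδl h3, mul_le_mul_of_nonneg_right h h3]
      have : upSum f p ≤ 4 / l * upSum φ p := by
        rw [div_mul_eq_mul_div, le_div_iff₀ hl]
        linarith
      linarith
  have hE := sum_sq_fst_mul_snd_le hX hY hμ hU hδ
  change ∑ p, φ p ^ 2 ≤ 4 * δ ^ 2 * ∑ p, f p ^ 2 at hE
  have hE' : √(∑ p, φ p ^ 2) ≤ 2 * δ * √(∑ p, f p ^ 2) := by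
    refine (Real.sqrt_le_sqrt hE).trans (le_of_eq ?_)
    rw [Real.sqrt_mul (by positivity), show 4 * δ ^ 2 = (2 * δ) ^ 2 by ring,
      Real.sqrt_sq (by positivity)]
  calc ∑ p, upSum f p * ρ p ≤ ∑ p, (l + 4 / l * upSum φ p) * ρ p :=
        Finset.sum_le_sum fun p _ => mul_le_mul_of_nonneg_right (pt p) (hρ p)
    _ = l * ∑ p, ρ p + 4 / l * ∑ p, upSum φ p * ρ p := by
        rw [Finset.mul_sum, Finset.mul_sum, ← Finset.sum_add_distrib]
        exact Finset.sum_congr rfl fun p _ => by ring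
    _ ≤ l * ∑ p, ρ p + 4 / l * (√(∑ p, φ p ^ 2) * √(energy ρ)) := by
        rw [sum_upSum_mul]
        gcongr
        exact Real.sum_mul_le_sqrt_mul_sqrt _ _ _
    _ ≤ l * ∑ p, ρ p + 4 / l * (2 * δ * √(∑ p, f p ^ 2) * √(energy ρ)) := by gcongr
    _ = _ := by ring

/-- The part of the energy carried by the elements of small potential is small. -/
theorem sum_sq_truncMass_le (hX : IsForest X) (hY : IsForest Y) {ν : X × Y → ℝ}
    (hν : ∀ p, 0 ≤ ν p) {A δ l : ℝ} (hν' : energy ν ≤ A * ∑ p, ν p)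
    (hδ0 : 0 ≤ δ) (hl : 0 < l) (hδl : 4 * δ ≤ l) :
    ∑ p, truncMass ν {p | upSum (downSum ν) p ≤ δ} p ^ 2 ≤
      (2 * l + 64 * (δ / l) ^ 2 * A) * ∑ p, ν p := by
  set U := {p | upSum (downSum ν) p ≤ δ} with hUdef
  have hU : IsUpperSet U := fun p q h hp => (upSum_antitone (downSum_nonneg hν) h).trans hp
  have hδ : ∀ p ∈ U, upSum (truncMass ν U) p ≤ δ := by
    intro p hp
    refine le_trans (upSum_mono (fun q => ?_) p) hp
    unfold truncMass
    split_ifs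
    · exact le_rfl
    · exact downSum_nonneg hν q
  have h1 := sum_upSum_truncMass_mul_le hX hY hν hν hU hδ0 hδ hl hδl
  have h2 : ∑ p, upSum (truncMass ν U) p * ν p = ∑ p, truncMass ν U p ^ 2 := by
    rw [sum_upSum_mul]
    refine Finset.sum_congr rfl fun p _ => ?_
    unfold truncMass
    split_ifs <;> ring
  rw [h2] at h1
  set S := ∑ p, truncMass ν U p ^ 2 with hS
  have hS0 : 0 ≤ S := Finset.sum_nonneg fun _ _ => sq_nonneg _
  have h3 := Real.sq_sqrt hS0
  have h4 := Real.sq_sqrt (energy_nonneg ν)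
  have h5 : 64 * (δ / l) ^ 2 * energy ν ≤ 64 * (δ / l) ^ 2 * (A * ∑ p, ν p) := by gcongr
  -- The cross term is at most `S / 2 + 32 (δ / l)² energy ν`, and `S / 2` is absorbed.
  nlinarith [sq_nonneg (√S - 8 * (δ / l) * √(energy ν))]

/-- A measure that satisfies the Carleson condition on lower sets satisfies the restricted energy
condition. -/
theorem restrictedEnergy_of_carleson (hX : IsForest X) (hY : IsForest Y) {μ : X × Y → ℝ}
    (hμ : ∀ p, 0 ≤ μ p) {C : ℝ}
    (hC : ∀ D : Set (X × Y), IsLowerSet D →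
      ∑ p, D.indicator (fun p => downSum μ p ^ 2) p ≤ C * massOn μ D) (hC0 : 0 ≤ C) :
    RestrictedEnergy μ (32768 * C) := by
  -- Sets of mass zero have ratio 0 by the convention for division, and their energy vanishes as
  -- well.
  obtain ⟨E, hE⟩ := Finite.exists_max fun E : Set (X × Y) => energy (E.indicator μ) / massOn μ E
  set A := energy (E.indicator μ) / massOn μ E with hAdef
  have hA0 : 0 ≤ A := div_nonneg (energy_nonneg _) (massOn_nonneg hμ _)
  have hH : RestrictedEnergy μ A := by
    intro F
    rcases (massOn_nonneg hμ F).eq_or_lt with h0 | h0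
    · have hz : ∀ p, F.indicator μ p = 0 := fun p =>
        (Finset.sum_eq_zero_iff_of_nonneg
          fun p _ => Set.indicator_nonneg (fun p _ => hμ p) p).1 h0.symm p (mem_univ p)
      rw [← h0, mul_zero]
      refine le_of_eq (Finset.sum_eq_zero fun p _ => ?_)
      rw [downSum, Finset.sum_eq_zero fun q _ => hz q]
      simp
    · have := hE F
      rwa [div_le_iff₀ h0] at this
  suffices hAC : A ≤ 32768 * C from fun F =>
    (hH F).trans (mul_le_mul_of_nonneg_right hAC (massOn_nonneg hμ F))
  rcases hA0.eq_or_lt with h0 | hA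
  · rw [← h0]
    positivity
  have hm : 0 < massOn μ E := by
    rcases (massOn_nonneg hμ E).eq_or_lt with h0 | h0
    · rw [hAdef, ← h0, div_zero] at hA
      exact absurd hA (lt_irrefl 0)
    · exact h0
  have hEA : energy (E.indicator μ) = A * massOn μ E := by
    rw [hAdef, div_mul_cancel₀ _ hm.ne']
  have hν : ∀ p, 0 ≤ E.indicator μ p := Set.indicator_nonneg fun p _ => hμ p
  -- With these values `2 l + 64 (δ / l)² A = A / 4 + A / 4`, so the low part takes half of the
  -- energy.
  have low := sum_sq_truncMass_le hX hY hν hEA.le (δ := A / 128) (l := A / 8) (by positivity)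
    (by positivity) (by linarith)
  set G := {p | A / 128 < upSum (downSum (E.indicator μ)) p} with hG
  have hGl : IsLowerSet G := isLowerSet_lt_upSum (downSum_nonneg hν) _
  have high := hC G hGl
  have hsplit : energy (E.indicator μ) ≤
      ∑ p, truncMass (E.indicator μ) {p | upSum (downSum (E.indicator μ)) p ≤ A / 128} p ^ 2 +
      ∑ p, G.indicator (fun p => downSum μ p ^ 2) p := by
    rw [energy, ← Finset.sum_add_distrib]
    refine Finset.sum_le_sum fun p _ => ?_
    by_cases hp : upSum (downSum (E.indicator μ)) p ≤ A / 128
    · rw [truncMass, if_pos (by exact hp), Set.indicator_of_notMem (show p ∉ G from not_lt.2 hp),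
        add_zero]
    · rw [truncMass, if_neg (by exact hp), Set.indicator_of_mem (show p ∈ G from lt_of_not_ge hp)]
      have := pow_le_pow_left₀ (downSum_nonneg hν p) (downSum_indicator_le hμ E p) 2
      simpa using this
  have hwk := sqrt_massOn_lt_potential_le hμ hA0 hH E (δ := A / 128) (by positivity)
  rw [← hG] at hwk
  have hmG : massOn μ G ≤ 16384 * massOn μ E := by
    have h1 := pow_le_pow_left₀ (Real.sqrt_nonneg _) hwk 2
    rw [mul_pow, Real.sq_sqrt (massOn_nonneg hμ _), Real.sq_sqrt (massOn_nonneg hμ _)] at h1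
    have h2 : A / (A / 128) = 128 := by field_simp
    rw [h2] at h1
    linarith
  have hratio : (A / 128 / (A / 8)) = 1 / 16 := by field_simp; norm_num
  rw [hratio] at low
  change _ ≤ _ * massOn μ E at low
  have h3 : C * massOn μ G ≤ C * (16384 * massOn μ E) := mul_le_mul_of_nonneg_left hmG hC0
  have h4 : A * massOn μ E ≤ 32768 * C * massOn μ E := by
    rw [hEA] at hsplit
    nlinarith
  exact le_of_mul_le_mul_right h4 hm

/-- Off-diagonal decay of the mutual energy of two restrictions of `μ`. -/
theorem sum_downSum_mul_le (hX : IsForest X) (hY : IsForest Y) {μ : X × Y → ℝ}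
    (hμ : ∀ p, 0 ≤ μ p) {A : ℝ} (hA : 0 ≤ A) (hH : RestrictedEnergy μ A) (E F : Set (X × Y))
    (n : ℕ) :
    ∑ p, downSum (E.indicator μ) p * downSum (F.indicator μ) p ≤
      A * (4 * (1 / 2) ^ n * (√(massOn μ E) * √(massOn μ F)) + 8 ^ n * massOn μ E) := by
  rcases hA.eq_or_lt with h0 | hA'
  · have := sum_downSum_mul_le_sqrt hA hH E F
    rw [← h0, zero_mul] at this ⊢
    exact this
  have hν : ∀ p, 0 ≤ E.indicator μ p := Set.indicator_nonneg fun p _ => hμ p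
  have hν' : ∀ p, 0 ≤ F.indicator μ p := Set.indicator_nonneg fun p _ => hμ p
  -- The choices keep `4 δ ≤ l` and make both `l` and `(δ / l)² A` of size `A 4⁻ⁿ`, whose square
  -- root supplies the decay `2⁻ⁿ`.
  set δ := A * (1 / 8) ^ n with hδ
  set l := 4 * A * (1 / 4) ^ n with hl
  have hδpos : 0 < δ := by positivity
  have hlpos : 0 < l := by positivity
  have h84 : ((1 : ℝ) / 8) ^ n ≤ (1 / 4) ^ n := pow_le_pow_left₀ (by norm_num) (by norm_num) n
  have low := sum_sq_truncMass_le hX hY hν (hH E) hδpos.le hlpos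
    (by rw [hδ, hl]; nlinarith)
  change _ ≤ _ * massOn μ E at low
  set U := {p | upSum (downSum (E.indicator μ)) p ≤ δ} with hU
  set G := {p | δ < upSum (downSum (E.indicator μ)) p} with hG
  have hGl : IsLowerSet G := isLowerSet_lt_upSum (downSum_nonneg hν) _
  have hcoef : 2 * l + 64 * (δ / l) ^ 2 * A ≤ (4 * (1 / 2) ^ n) ^ 2 * A := by
    have h1 : δ / l = 1 / 4 * (1 / 2) ^ n := by
      have : ((1 : ℝ) / 8) ^ n = (1 / 4) ^ n * (1 / 2) ^ n := by rw [← mul_pow]; norm_num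
      rw [hδ, hl, this]
      field_simp
    have h2 : ((1 : ℝ) / 4) ^ n = ((1 / 2) ^ n) ^ 2 := by rw [← pow_mul, mul_comm, pow_mul]; norm_num
    rw [h1, hl, h2]
    nlinarith [mul_nonneg hA (sq_nonneg (((1 : ℝ) / 2) ^ n))]
  have lowS : √(∑ p, truncMass (E.indicator μ) U p ^ 2) ≤
      4 * (1 / 2) ^ n * (√A * √(massOn μ E)) := by
    refine (Real.sqrt_le_sqrt (low.trans
      (mul_le_mul_of_nonneg_right hcoef (massOn_nonneg hμ E)))).trans (le_of_eq ?_)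
    rw [mul_assoc, Real.sqrt_mul (by positivity), Real.sqrt_sq (by positivity), Real.sqrt_mul hA]
  have lowF : √(energy (F.indicator μ)) ≤ √A * √(massOn μ F) := by
    rw [← Real.sqrt_mul hA]
    exact Real.sqrt_le_sqrt (hH F)
  have first : ∑ p, truncMass (E.indicator μ) U p * downSum (F.indicator μ) p ≤
      A * (4 * (1 / 2) ^ n * (√(massOn μ E) * √(massOn μ F))) := by
    refine (Real.sum_mul_le_sqrt_mul_sqrt _ _ _).trans
      ((mul_le_mul lowS lowF (Real.sqrt_nonneg _) (by positivity)).trans (le_of_eq ?_))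
    have := Real.mul_self_sqrt hA
    linear_combination (4 * (1 / 2) ^ n * √(massOn μ E) * √(massOn μ F)) * this
  -- At nodes of the lower set `G` only `F ∩ G` contributes to the mass of `F`, and the weak-type
  -- bound compares `G` with `E`.
  have second : ∑ p, downSum (E.indicator μ) p * downSum ((F ∩ G).indicator μ) p ≤
      A * (8 ^ n * massOn μ E) := by
    have hwk := sqrt_massOn_lt_potential_le hμ hA hH E hδpos
    have h1 : √(massOn μ (F ∩ G)) ≤ A / δ * √(massOn μ E) :=
      (Real.sqrt_le_sqrt (massOn_mono hμ Set.inter_subset_right)).trans hwk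
    have h2 : A / δ = 8 ^ n := by
      rw [hδ, one_div, inv_pow]
      field_simp
    rw [h2] at h1
    refine (sum_downSum_mul_le_sqrt hA hH E (F ∩ G)).trans (mul_le_mul_of_nonneg_left ?_ hA)
    refine (mul_le_mul_of_nonneg_left h1 (Real.sqrt_nonneg _)).trans (le_of_eq ?_)
    have := Real.mul_self_sqrt (massOn_nonneg hμ E)
    linear_combination (8 : ℝ) ^ n * this
  have hsplit : ∑ p, downSum (E.indicator μ) p * downSum (F.indicator μ) p ≤
      ∑ p, truncMass (E.indicator μ) U p * downSum (F.indicator μ) p +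
      ∑ p, downSum (E.indicator μ) p * downSum ((F ∩ G).indicator μ) p := by
    rw [← Finset.sum_add_distrib]
    refine Finset.sum_le_sum fun p _ => ?_
    by_cases hp : p ∈ U
    · rw [truncMass, if_pos hp]
      have : 0 ≤ downSum ((F ∩ G).indicator μ) p :=
        downSum_nonneg (Set.indicator_nonneg fun p _ => hμ p) p
      nlinarith [downSum_nonneg hν p]
    · have hpG : p ∈ G := not_le.1 (show ¬upSum (downSum (E.indicator μ)) p ≤ δ from hp)
      rw [truncMass, if_neg hp, downSum_indicator_inter hGl F hpG]
      simp
  calc _ ≤ _ := hsplit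
    _ ≤ _ := add_le_add first second
    _ = _ := by ring

end ProductEnergy

/-! ### From restricted energy to the embedding by level sets. -/

section Levels

theorem sum_half_pow_natAbs_sub_le (S : Finset ℤ) (j : ℤ) :
    ∑ k ∈ S, ((1 : ℝ) / 2) ^ (j - k).natAbs ≤ 4 := by
  -- On either side of `j` the exponents are distinct, so each side is bounded by the geometric
  -- series.
  have aux : ∀ T : Finset ℤ, Set.InjOn (fun k : ℤ => (j - k).natAbs) T →
      ∑ k ∈ T, ((1 : ℝ) / 2) ^ (j - k).natAbs ≤ 2 := by
    intro T hT
    rw [← Finset.sum_image (f := fun n : ℕ => ((1 : ℝ) / 2) ^ n) hT]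
    exact (summable_geometric_two.sum_le_tsum _ fun n _ => by positivity).trans_eq
      tsum_geometric_two
  rw [← Finset.sum_filter_add_sum_filter_not S (fun k => k ≤ j)]
  have h1 := aux (S.filter fun k => k ≤ j) (by
    intro a ha b hb hab
    simp only [coe_filter, Set.mem_ofPred_eq] at ha hb hab
    omega)
  have h2 := aux (S.filter fun k => ¬ k ≤ j) (by
    intro a ha b hb hab
    simp only [coe_filter, Set.mem_ofPred_eq] at ha hb hab
    omega)
  linarith

theorem sum_sum_half_pow_mul_le (S : Finset ℤ) {b : ℤ → ℝ} (hb : ∀ j, 0 ≤ b j) :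
    ∑ j ∈ S, ∑ k ∈ S, ((1 : ℝ) / 2) ^ (j - k).natAbs * (b j + b k) ≤ 8 * ∑ j ∈ S, b j := by
  have h1 : ∑ j ∈ S, ∑ k ∈ S, ((1 : ℝ) / 2) ^ (j - k).natAbs * b j ≤ 4 * ∑ j ∈ S, b j := by
    rw [Finset.mul_sum]
    refine Finset.sum_le_sum fun j _ => ?_
    rw [← Finset.sum_mul]
    exact mul_le_mul_of_nonneg_right (sum_half_pow_natAbs_sub_le S j) (hb j)
  have h2 : ∑ j ∈ S, ∑ k ∈ S, ((1 : ℝ) / 2) ^ (j - k).natAbs * b k ≤ 4 * ∑ j ∈ S, b j := by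
    rw [Finset.sum_comm]
    refine le_trans (le_of_eq ?_) h1
    refine Finset.sum_congr rfl fun j _ => Finset.sum_congr rfl fun k _ => ?_
    rw [← Int.natAbs_neg, neg_sub]
  simp only [mul_add, Finset.sum_add_distrib]
  linarith

variable {X Y : Type*} [Fintype X] [Preorder X] [Fintype Y] [Preorder Y]

theorem scaled_sum_downSum_mul_le_of_le (hX : IsForest X) (hY : IsForest Y) {μ : X × Y → ℝ}
    (hμ : ∀ p, 0 ≤ μ p) {A : ℝ} (hA : 0 ≤ A) (hH : RestrictedEnergy μ A)
    (E : ℤ → Set (X × Y)) {j k : ℤ} (hjk : k ≤ j) :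
    16 ^ j * 16 ^ k *
        ∑ p, downSum ((E j).indicator μ) p * downSum ((E k).indicator μ) p ≤
      3 * A * ((1 / 2) ^ (j - k).natAbs *
        ((16 ^ j) ^ 2 * massOn μ (E j) + (16 ^ k) ^ 2 * massOn μ (E k))) := by
  obtain ⟨n, rfl⟩ : ∃ n : ℕ, j = k + n := ⟨(j - k).toNat, by omega⟩
  have hn : (k + (n : ℤ) - k).natAbs = n := by omega
  have h := sum_downSum_mul_le hX hY hμ hA hH (E (k + n)) (E k) n
  rw [hn]
  -- Base 16 is chosen so that the level gap `16ⁿ` beats the loss `8ⁿ` of the decay estimate,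
  -- leaving `2⁻ⁿ`.
  have hpow : (16 : ℝ) ^ k * 8 ^ n = (1 / 2) ^ n * 16 ^ (k + (n : ℤ)) := by
    rw [zpow_add₀ (by norm_num), zpow_natCast, mul_left_comm, ← mul_pow]
    norm_num
  set a : ℝ := 16 ^ (k + (n : ℤ)) with ha
  set b : ℝ := 16 ^ k with hb
  have ha0 : 0 < a := by positivity
  have hb0 : 0 < b := by positivity
  set x := √(massOn μ (E (k + n))) with hx
  set y := √(massOn μ (E k)) with hy
  have hx2 : massOn μ (E (k + n)) = x ^ 2 := (Real.sq_sqrt (massOn_nonneg hμ _)).symm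
  have hy2 : massOn μ (E k) = y ^ 2 := (Real.sq_sqrt (massOn_nonneg hμ _)).symm
  rw [hx2] at h ⊢
  rw [hy2]
  refine (mul_le_mul_of_nonneg_left h (by positivity)).trans ?_
  have e1 : a * b * (A * (4 * (1 / 2) ^ n * (x * y) + 8 ^ n * x ^ 2)) =
      A * (1 / 2) ^ n * (4 * (a * x) * (b * y) + (a * x) ^ 2) := by
    linear_combination A * a * x ^ 2 * hpow
  rw [e1]
  have e2 : 3 * A * ((1 / 2) ^ n * (a ^ 2 * x ^ 2 + b ^ 2 * y ^ 2)) =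
      A * (1 / 2) ^ n * (3 * ((a * x) ^ 2 + (b * y) ^ 2)) := by ring
  rw [e2]
  refine mul_le_mul_of_nonneg_left ?_ (by positivity)
  nlinarith [sq_nonneg (a * x - b * y), sq_nonneg (b * y)]

theorem scaled_sum_downSum_mul_le (hX : IsForest X) (hY : IsForest Y) {μ : X × Y → ℝ}
    (hμ : ∀ p, 0 ≤ μ p) {A : ℝ} (hA : 0 ≤ A) (hH : RestrictedEnergy μ A)
    (E : ℤ → Set (X × Y)) (j k : ℤ) :
    16 ^ j * 16 ^ k *
        ∑ p, downSum ((E j).indicator μ) p * downSum ((E k).indicator μ) p ≤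
      3 * A * ((1 / 2) ^ (j - k).natAbs *
        ((16 ^ j) ^ 2 * massOn μ (E j) + (16 ^ k) ^ 2 * massOn μ (E k))) := by
  rcases le_total k j with h | h
  · exact scaled_sum_downSum_mul_le_of_le hX hY hμ hA hH E h
  · have := scaled_sum_downSum_mul_le_of_le hX hY hμ hA hH E h
    rw [← Int.natAbs_neg, neg_sub] at this
    simp only [mul_comm (downSum ((E k).indicator μ) _)] at this
    linarith

/-- The restricted energy condition implies the embedding for nonnegative functions. -/
theorem energy_mul_le_of_restrictedEnergy (hX : IsForest X) (hY : IsForest Y) {μ : X × Y → ℝ}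
    (hμ : ∀ p, 0 ≤ μ p) {A : ℝ} (hA : 0 ≤ A) (hH : RestrictedEnergy μ A) {ψ : X × Y → ℝ}
    (hψ : ∀ p, 0 ≤ ψ p) :
    energy (fun p => ψ p * μ p) ≤ 6144 * A * ∑ p, ψ p ^ 2 * μ p := by
  classical
  -- Points where `ψ` vanishes get an arbitrary level; the sets `E j` below exclude them.
  have hex : ∀ p, ∃ j : ℤ, 0 < ψ p → ψ p ∈ Set.Ioc ((16 : ℝ) ^ j) (16 ^ (j + 1)) := by
    intro p
    by_cases h : 0 < ψ p
    · obtain ⟨j, hj⟩ := exists_mem_Ioc_zpow h (by norm_num : (1 : ℝ) < 16)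
      exact ⟨j, fun _ => hj⟩
    · exact ⟨0, fun h' => absurd h' h⟩
  choose J hJ using hex
  set S : Finset ℤ := univ.image J with hS
  set E : ℤ → Set (X × Y) := fun j => {p | 0 < ψ p ∧ J p = j} with hE
  have hind : ∀ (g : X × Y → ℝ) (j : ℤ) (p : X × Y), (E j).indicator g p =
      if J p = j then (if 0 < ψ p then g p else 0) else 0 := by
    intro g j p
    rw [Set.indicator_apply, ← ite_and]
    exact if_congr (by simp [hE, and_comm]) rfl rfl
  have hsum : ∀ (c : ℤ → ℝ) (p : X × Y), ∑ j ∈ S, c j * (E j).indicator μ p =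
      if 0 < ψ p then c (J p) * μ p else 0 := by
    intro c p
    simp only [hind, mul_ite, mul_zero]
    rw [Finset.sum_ite_eq, if_pos (by simp [hS])]
  have hup : ∀ p, ψ p * μ p ≤ ∑ j ∈ S, 16 * 16 ^ j * (E j).indicator μ p := by
    intro p
    rw [hsum (fun j => 16 * 16 ^ j)]
    split_ifs with h
    · refine mul_le_mul_of_nonneg_right ((hJ p h).2.trans (le_of_eq ?_)) (hμ p)
      rw [zpow_add_one₀ (by norm_num), mul_comm]
    · rw [le_antisymm (not_lt.1 h) (hψ p), zero_mul]
  have hdown : ∀ p, ∑ j ∈ S, (16 ^ j) ^ 2 * (E j).indicator μ p ≤ ψ p ^ 2 * μ p := by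
    intro p
    rw [hsum (fun j => (16 ^ j) ^ 2)]
    split_ifs with h
    · exact mul_le_mul_of_nonneg_right
        (pow_le_pow_left₀ (by positivity) (hJ p h).1.le 2) (hμ p)
    · exact mul_nonneg (sq_nonneg _) (hμ p)
  have hdS : ∀ p, downSum (fun p => ψ p * μ p) p ≤
      ∑ j ∈ S, 16 * 16 ^ j * downSum ((E j).indicator μ) p := by
    intro p
    refine (downSum_mono hup p).trans (le_of_eq ?_)
    simp only [downSum, Finset.mul_sum]
    rw [Finset.sum_comm]
  have hd0 : ∀ p, 0 ≤ downSum (fun p => ψ p * μ p) p :=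
    downSum_nonneg fun p => mul_nonneg (hψ p) (hμ p)
  -- The constant is `6144 = 16² · 3 · 8`: rounding up to the next level, the mutual energy bound,
  -- and the geometric double sum.
  calc energy (fun p => ψ p * μ p)
      ≤ ∑ p, (∑ j ∈ S, 16 * 16 ^ j * downSum ((E j).indicator μ) p) ^ 2 :=
        Finset.sum_le_sum fun p _ => pow_le_pow_left₀ (hd0 p) (hdS p) 2
    _ = 256 * ∑ j ∈ S, ∑ k ∈ S, 16 ^ j * 16 ^ k *
          ∑ p, downSum ((E j).indicator μ) p * downSum ((E k).indicator μ) p := by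
        simp only [sq, Finset.sum_mul_sum]
        rw [Finset.sum_comm, Finset.mul_sum]
        refine Finset.sum_congr rfl fun j _ => ?_
        rw [Finset.sum_comm, Finset.mul_sum]
        refine Finset.sum_congr rfl fun k _ => ?_
        rw [Finset.mul_sum, Finset.mul_sum]
        exact Finset.sum_congr rfl fun p _ => by ring
    _ ≤ 256 * ∑ j ∈ S, ∑ k ∈ S, 3 * A * ((1 / 2) ^ (j - k).natAbs *
        ((16 ^ j) ^ 2 * massOn μ (E j) + (16 ^ k) ^ 2 * massOn μ (E k))) := by
        refine mul_le_mul_of_nonneg_left (Finset.sum_le_sum fun j _ =>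
          Finset.sum_le_sum fun k _ => ?_) (by norm_num)
        exact scaled_sum_downSum_mul_le hX hY hμ hA hH E j k
    _ ≤ 256 * (3 * A * (8 * ∑ j ∈ S, (16 ^ j) ^ 2 * massOn μ (E j))) := by
        simp only [← Finset.mul_sum]
        gcongr
        exact sum_sum_half_pow_mul_le S (b := fun j => (16 ^ j) ^ 2 * massOn μ (E j))
          fun j => mul_nonneg (by positivity) (massOn_nonneg hμ _)
    _ = 6144 * A * ∑ p, ∑ j ∈ S, (16 ^ j) ^ 2 * (E j).indicator μ p := by
        rw [Finset.sum_comm]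
        simp only [massOn, Finset.mul_sum]
        exact Finset.sum_congr rfl fun j _ => Finset.sum_congr rfl fun p _ => by ring
    _ ≤ 6144 * A * ∑ p, ψ p ^ 2 * μ p := by
        gcongr with p _
        exact hdown p

end Levels

/-- Closes both duality arguments: Cauchy–Schwarz gives the first inequality, the assumed embedding
the second, and `x` cancels. -/
theorem le_mul_of_sq_le {x y b C : ℝ} (hx : 0 ≤ x) (hb : 0 ≤ b) (hC : 0 ≤ C)
    (h : x ^ 2 ≤ y * b) (hy : y ≤ C * x) : x ≤ C * b := by
  rcases hx.eq_or_lt with h0 | h0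
  · rw [← h0]
    positivity
  · refine le_of_mul_le_mul_right ?_ h0
    nlinarith [mul_le_mul_of_nonneg_right hy hb]

/-! ### Geometry of dyadic intervals. -/

namespace DyadicTree

variable {N : ℕ}

instance : Preorder (DyadicTree N) := Preorder.lift DyadicTree.interval

theorem le_iff {I J : DyadicTree N} : I ≤ J ↔ I.interval ⊆ J.interval := Iff.rfl

theorem pos_lt (I : DyadicTree N) : I.pos < 2 ^ I.gen := I.2.2

theorem gen_le (I : DyadicTree N) : I.gen ≤ N := Nat.lt_succ_iff.1 I.1.2

theorem ext_gen_pos {I J : DyadicTree N} (hg : I.gen = J.gen) (hp : I.pos = J.pos) : I = J := by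
  obtain ⟨⟨k, hk⟩, i, hi⟩ := I
  obtain ⟨⟨l, hl⟩, j, hj⟩ := J
  change k = l at hg
  change i = j at hp
  subst hg hp
  rfl

theorem endpoints_lt (I : DyadicTree N) :
    (I.pos : ℝ) / 2 ^ I.gen < ((I.pos : ℝ) + 1) / 2 ^ I.gen := by
  gcongr
  exact lt_add_one _

theorem interval_nonempty (I : DyadicTree N) : I.interval.Nonempty :=
  Set.nonempty_Icc.2 I.endpoints_lt.le

/-- Of two overlapping dyadic intervals, the one of the later generation lies in the other. -/
theorem le_of_overlap {I J : DyadicTree N} (hg : J.gen ≤ I.gen)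
    (h1 : (I.pos : ℝ) / 2 ^ I.gen < ((J.pos : ℝ) + 1) / 2 ^ J.gen)
    (h2 : (J.pos : ℝ) / 2 ^ J.gen < ((I.pos : ℝ) + 1) / 2 ^ I.gen) : I ≤ J := by
  obtain ⟨d, hd⟩ := Nat.exists_eq_add_of_le hg
  have hpow : (2 : ℝ) ^ I.gen = 2 ^ d * 2 ^ J.gen := by rw [hd, pow_add, mul_comm]
  have hscale : ∀ x : ℝ, x / 2 ^ J.gen = x * 2 ^ d / 2 ^ I.gen := by
    intro x
    rw [hpow, mul_comm x, mul_div_mul_left _ _ (by positivity)]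
  have hI : (0 : ℝ) < 2 ^ I.gen := by positivity
  rw [hscale, div_lt_div_iff_of_pos_right hI] at h1 h2
  have h1' : I.pos < (J.pos + 1) * 2 ^ d := by exact_mod_cast h1
  have h2' : J.pos * 2 ^ d < I.pos + 1 := by exact_mod_cast h2
  rw [le_iff, interval, interval]
  refine Set.Icc_subset_Icc ?_ ?_
  · rw [hscale, div_le_div_iff_of_pos_right hI]
    exact_mod_cast Nat.lt_succ_iff.1 h2'
  · rw [hscale, div_le_div_iff_of_pos_right hI]
    exact_mod_cast h1'

theorem isForest : IsForest (DyadicTree N) := by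
  intro I J L hJ hL
  rw [le_iff, interval, interval, Set.Icc_subset_Icc_iff I.endpoints_lt.le] at hJ hL
  -- Both intervals contain the nondegenerate interval of `I`, so they overlap in more than an
  -- endpoint.
  have h1 := (hJ.1.trans_lt I.endpoints_lt).trans_le hL.2
  have h2 := (hL.1.trans_lt I.endpoints_lt).trans_le hJ.2
  rcases le_total L.gen J.gen with h | h
  · exact Or.inl (le_of_overlap h h1 h2)
  · exact Or.inr (le_of_overlap h h2 h1)

theorem exists_nat_le_le_add_one {a b : ℕ} (hab : a < b) {x : ℝ} (ha : a ≤ x) (hb : x ≤ b) :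
    ∃ p, a ≤ p ∧ p < b ∧ (p : ℝ) ≤ x ∧ x ≤ p + 1 := by
  have hx : 0 ≤ x := (Nat.cast_nonneg a).trans ha
  rcases hb.eq_or_lt with h | h
  -- At the right end the floor would be `b` itself, one cell too far.
  · refine ⟨b - 1, by omega, by omega, ?_, ?_⟩
    · rw [h]
      exact_mod_cast Nat.sub_le b 1
    · rw [h]
      exact_mod_cast (by omega : b ≤ b - 1 + 1)
  · exact ⟨⌊x⌋₊, Nat.le_floor ha, (Nat.floor_lt hx).2 h, Nat.floor_le hx,
      (Nat.lt_floor_add_one x).le⟩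

/-- A dyadic interval is covered by the leaves below it. -/
theorem exists_leaf_le {I : DyadicTree N} {x : ℝ} (hx : x ∈ I.interval) :
    ∃ L : DyadicTree N, L.gen = N ∧ L ≤ I ∧ x ∈ L.interval := by
  obtain ⟨d, hd⟩ := Nat.exists_eq_add_of_le I.gen_le
  have hpow : (2 : ℝ) ^ N = 2 ^ I.gen * 2 ^ d := by
    conv_lhs => rw [hd, pow_add]
  have hN : (0 : ℝ) < 2 ^ N := by positivity
  have hscale : ∀ y : ℝ, y / 2 ^ I.gen = y * 2 ^ d / 2 ^ N := by
    intro y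
    rw [hpow, mul_div_mul_right _ _ (by positivity)]
  obtain ⟨h1, h2⟩ := hx
  have hlt : I.pos * 2 ^ d < (I.pos + 1) * 2 ^ d := by gcongr; omega
  rw [hscale, div_le_iff₀ hN] at h1
  rw [hscale, le_div_iff₀ hN] at h2
  obtain ⟨p, hp1, hp2, hp3, hp4⟩ := exists_nat_le_le_add_one hlt (x := x * 2 ^ N)
    (by push_cast; exact h1) (by push_cast; exact h2)
  have hpN : p < 2 ^ N := by
    refine hp2.trans_le ?_
    conv_rhs => rw [hd, pow_add]
    exact Nat.mul_le_mul_right _ I.pos_lt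
  refine ⟨⟨⟨N, Nat.lt_succ_self N⟩, ⟨p, hpN⟩⟩, rfl, ?_, ?_⟩
  · change Set.Icc ((p : ℝ) / 2 ^ N) (((p : ℝ) + 1) / 2 ^ N) ⊆ Set.Icc _ _
    refine Set.Icc_subset_Icc ?_ ?_
    · rw [hscale]
      gcongr
      exact_mod_cast hp1
    · rw [hscale]
      gcongr
      exact_mod_cast hp2
  · change x ∈ Set.Icc ((p : ℝ) / 2 ^ N) (((p : ℝ) + 1) / 2 ^ N)
    exact ⟨(div_le_iff₀ hN).2 hp3, (le_div_iff₀ hN).2 hp4⟩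

/-- The midpoint of the interval of a node. -/
noncomputable def midpoint (I : DyadicTree N) : ℝ := ((I.pos : ℝ) + 1 / 2) / 2 ^ I.gen

theorem midpoint_mem (I : DyadicTree N) : I.midpoint ∈ I.interval := by
  constructor <;> unfold midpoint <;> gcongr <;> norm_num

theorem eq_of_midpoint_mem {I J : DyadicTree N} (hg : I.gen = J.gen)
    (h : I.midpoint ∈ J.interval) : I = J := by
  refine ext_gen_pos hg ?_
  obtain ⟨h1, h2⟩ := h
  have hJ : (0 : ℝ) < 2 ^ J.gen := by positivity
  rw [midpoint, hg, div_le_div_iff_of_pos_right hJ] at h1 h2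
  have h3 : (J.pos : ℝ) < (I.pos + 1 : ℕ) := by push_cast; linarith
  have h4 : (I.pos : ℝ) < (J.pos + 1 : ℕ) := by push_cast; linarith
  have h3' := Nat.cast_lt.1 h3
  have h4' := Nat.cast_lt.1 h4
  omega

end DyadicTree

/-! ### The bi-tree as a product of two forests. -/

namespace BiTree

variable {N : ℕ}

instance : Preorder (BiTree N) := Preorder.lift BiTree.rect

theorem le_iff {α β : BiTree N} : α ≤ β ↔ α.rect ⊆ β.rect := Iff.rfl

theorem le_iff_prod {α β : BiTree N} : α ≤ β ↔ α.1 ≤ β.1 ∧ α.2 ≤ β.2 := by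
  constructor
  · intro h
    rcases Set.prod_subset_prod_iff.1 (le_iff.1 h) with h' | h' | h'
    · exact h'
    · exact absurd h' α.1.interval_nonempty.ne_empty
    · exact absurd h' α.2.interval_nonempty.ne_empty
  · exact fun h => Set.prod_mono h.1 h.2

theorem exists_boundary_le {α : BiTree N} {x : ℝ × ℝ} (hx : x ∈ α.rect) :
    ∃ ω ∈ boundary N, ω ≤ α ∧ x ∈ ω.rect := by
  obtain ⟨I, hI, hI', hxI⟩ := DyadicTree.exists_leaf_le hx.1
  obtain ⟨J, hJ, hJ', hxJ⟩ := DyadicTree.exists_leaf_le hx.2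
  exact ⟨(I, J), mem_filter.2 ⟨mem_univ _, hI, hJ⟩, le_iff_prod.2 ⟨hI', hJ'⟩, hxI, hxJ⟩

/-- Closed squares share edges, so the centre of the square is tested: it lies in no other boundary
square. -/
theorem mem_of_rect_subset_union {E : Finset (BiTree N)} (hE : E ⊆ boundary N) {ω : BiTree N}
    (hω : ω ∈ boundary N) (h : ω.rect ⊆ union E) : ω ∈ E := by
  have hmid : (ω.1.midpoint, ω.2.midpoint) ∈ ω.rect := ⟨ω.1.midpoint_mem, ω.2.midpoint_mem⟩
  obtain ⟨ω', hω', hmem⟩ := Set.mem_iUnion₂.1 (h hmid)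
  have hb := (mem_filter.1 hω).2
  have hb' := (mem_filter.1 (hE hω')).2
  have h1 := DyadicTree.eq_of_midpoint_mem (hb.1.trans hb'.1.symm) hmem.1
  have h2 := DyadicTree.eq_of_midpoint_mem (hb.2.trans hb'.2.symm) hmem.2
  rwa [show ω = ω' from Prod.ext h1 h2]

theorem sum_hardy_mul (φ g : BiTree N → ℝ) :
    ∑ α, hardy φ α * g α = ∑ α, φ α * hardyDual g α :=
  sum_upSum_mul φ g

theorem hardyDual_eq_downSum (ψ : BiTree N → ℝ) (α : BiTree N) :
    hardyDual ψ α = downSum (P := DyadicTree N × DyadicTree N) ψ α := by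
  classical
  exact Finset.sum_congr (Finset.filter_congr fun β _ => le_iff_prod) fun _ _ => rfl

theorem abs_hardyDual_le (ψ : BiTree N → ℝ) (α : BiTree N) :
    |hardyDual ψ α| ≤ hardyDual (fun β => |ψ β|) α :=
  Finset.abs_sum_le_sum_abs _ _

end BiTree

/-! ### Implications between the four conditions. -/

namespace BoundaryMeasure

open BiTree

variable {N : ℕ} (μ : BoundaryMeasure N)

theorem sum_boundary_mul (g : BiTree N → ℝ) :
    ∑ ω ∈ boundary N, g ω * μ.mass ω = ∑ ω, g ω * μ.mass ω :=
  Finset.sum_subset (subset_univ _) fun ω _ hω => by rw [μ.eq_zero ω hω, mul_zero]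

theorem rectMass_eq_hardyDual (α : BiTree N) : μ.rectMass α = hardyDual μ.mass α := by
  classical
  unfold rectMass hardyDual
  refine Finset.sum_subset (Finset.filter_subset_filter _ (subset_univ _)) fun ω hω hω' => ?_
  refine μ.eq_zero ω fun h => hω' ?_
  exact mem_filter.2 ⟨h, (mem_filter.1 hω).2⟩

variable {μ}

/-- With `g = 𝕀* (ψ μ)`, the sum of `g²` is the pairing of `𝕀 g` with `ψ` in `L²(μ)`; the embedding
is applied to `g` itself. -/
theorem IsEmbedding.isDualEmbedding {C : ℝ} (hC : 0 ≤ C) (h : μ.IsEmbedding C) :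
    μ.IsDualEmbedding C := by
  intro ψ
  set g := hardyDual fun β => ψ β * μ.mass β with hg
  have h1 := h g
  simp only [sq_abs] at h1 ⊢
  rw [sum_boundary_mul μ fun ω => hardy g ω ^ 2] at h1
  rw [sum_boundary_mul μ fun ω => ψ ω ^ 2]
  set x := ∑ α, g α ^ 2 with hx
  have hx0 : 0 ≤ x := Finset.sum_nonneg fun _ _ => sq_nonneg _
  have e : x = ∑ α, hardy g α * (ψ α * μ.mass α) := by
    rw [sum_hardy_mul]
    exact Finset.sum_congr rfl fun α _ => sq _
  have cs : x ^ 2 ≤ (∑ α, hardy g α ^ 2 * μ.mass α) * ∑ α, ψ α ^ 2 * μ.mass α := by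
    rw [e]
    refine Finset.sum_sq_le_sum_mul_sum_of_sq_le_mul _
      (fun α _ => mul_nonneg (sq_nonneg _) (μ.nonneg α))
      (fun α _ => mul_nonneg (sq_nonneg _) (μ.nonneg α)) fun α _ => le_of_eq (by ring)
  have hb : 0 ≤ ∑ α, ψ α ^ 2 * μ.mass α :=
    Finset.sum_nonneg fun α _ => mul_nonneg (sq_nonneg _) (μ.nonneg α)
  exact le_mul_of_sq_le hx0 hb hC cs h1

theorem IsDualEmbedding.isEmbedding {C : ℝ} (hC : 0 ≤ C) (h : μ.IsDualEmbedding C) :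
    μ.IsEmbedding C := by
  intro φ
  have h1 := h (hardy φ)
  simp only [sq_abs] at h1 ⊢
  set x := ∑ ω ∈ boundary N, hardy φ ω ^ 2 * μ.mass ω with hx
  have hx0 : 0 ≤ x := Finset.sum_nonneg fun α _ => mul_nonneg (sq_nonneg _) (μ.nonneg α)
  have e : x = ∑ α, φ α * hardyDual (fun β => hardy φ β * μ.mass β) α := by
    rw [hx, sum_boundary_mul μ fun ω => hardy φ ω ^ 2, ← sum_hardy_mul]
    exact Finset.sum_congr rfl fun α _ => by ring
  have cs : x ^ 2 ≤
      (∑ α, hardyDual (fun β => hardy φ β * μ.mass β) α ^ 2) * ∑ α, φ α ^ 2 := by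
    rw [e, mul_comm]
    exact Finset.sum_mul_sq_le_sq_mul_sq _ _ _
  exact le_mul_of_sq_le hx0 (Finset.sum_nonneg fun _ _ => sq_nonneg _) hC cs h1

theorem IsDualEmbedding.mono {C C' : ℝ} (hC : C ≤ C') (h : μ.IsDualEmbedding C) :
    μ.IsDualEmbedding C' := fun ψ =>
  (h ψ).trans (mul_le_mul_of_nonneg_right hC
    (Finset.sum_nonneg fun ω _ => mul_nonneg (sq_nonneg _) (μ.nonneg ω)))

/-- The test function is the indicator of `E`: every boundary square inside a rectangle of `𝓡_E`
belongs to `E`, so no mass is lost there. -/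
theorem IsDualEmbedding.isCarleson {C : ℝ} (h : μ.IsDualEmbedding C) : μ.IsCarleson C := by
  classical
  intro E hE
  have h1 := h fun ω => if ω ∈ E then 1 else 0
  have e1 : ∑ ω ∈ boundary N, |(if ω ∈ E then (1 : ℝ) else 0)| ^ 2 * μ.mass ω = μ.measure E := by
    rw [measure,
      ← Finset.sum_subset hE (f := fun ω => |(if ω ∈ E then (1 : ℝ) else 0)| ^ 2 * μ.mass ω)]
    · exact Finset.sum_congr rfl fun ω hω => by simp [hω]
    · exact fun ω _ hω => by simp [hω]
  rw [e1] at h1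
  refine le_trans ?_ h1
  refine le_trans (le_of_eq ?_) (Finset.sum_le_sum_of_subset_of_nonneg (subset_univ (rectsIn E))
    fun _ _ _ => sq_nonneg _)
  refine Finset.sum_congr rfl fun R hR => ?_
  rw [sq_abs, rectMass_eq_hardyDual]
  congr 1
  refine Finset.sum_congr rfl fun ω hω => ?_
  by_cases hb : ω ∈ boundary N
  · have hωE : ω ∈ E := mem_of_rect_subset_union hE hb
      (Set.Subset.trans (mem_filter.1 hω).2 (mem_filter.1 hR).2)
    simp [hωE]
  · simp [μ.eq_zero ω hb]

theorem IsDualEmbedding.restrict {C : ℝ} (h : μ.IsDualEmbedding C) (E : Finset (BiTree N)) :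
    (μ.restrict E).IsDualEmbedding C := by
  intro ψ
  have h1 := h fun ω => if ω ∈ E then ψ ω else 0
  refine le_of_eq_of_le ?_ (h1.trans_eq ?_)
  · refine Finset.sum_congr rfl fun α _ => ?_
    congr 3
    funext β
    change ψ β * (if β ∈ E then μ.mass β else 0) = _
    split_ifs <;> simp
  · congr 1
    refine Finset.sum_congr rfl fun ω _ => ?_
    change _ = |ψ ω| ^ 2 * (if ω ∈ E then μ.mass ω else 0)
    split_ifs <;> simp

theorem IsDualEmbedding.isHereditaryCarleson {C : ℝ} (h : μ.IsDualEmbedding C) :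
    μ.IsHereditaryCarleson C := fun E _ => (h.restrict E).isCarleson

theorem IsHereditaryCarleson.isCarleson {C : ℝ} (h : μ.IsHereditaryCarleson C) :
    μ.IsCarleson C := by
  have hμ : μ.restrict (boundary N) = μ := by
    obtain ⟨m, h0, h1⟩ := μ
    simp only [BoundaryMeasure.restrict, BoundaryMeasure.mk.injEq]
    funext ω
    split_ifs with hω
    · rfl
    · exact (h1 ω hω).symm
  simpa only [hμ] using h (boundary N) (Finset.Subset.refl _)

theorem IsCarleson.isDualEmbedding {C : ℝ} (hC : 0 ≤ C) (h : μ.IsCarleson C) :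
    μ.IsDualEmbedding (201326592 * C) := by
  classical
  have hlow : ∀ D : Set (DyadicTree N × DyadicTree N), IsLowerSet D →
      ∑ p, D.indicator (fun p => downSum (P := DyadicTree N × DyadicTree N) μ.mass p ^ 2) p ≤
        C * massOn (P := DyadicTree N × DyadicTree N) μ.mass D := by
    intro D hD
    set E : Finset (BiTree N) := (boundary N).filter fun ω => ω ∈ D with hE
    have h1 := h E (Finset.filter_subset _ _)
    have e1 : μ.measure E = massOn (P := DyadicTree N × DyadicTree N) μ.mass D := by
      rw [measure, hE, Finset.sum_filter]
      refine Finset.sum_subset (subset_univ _) fun ω _ hω => ?_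
      simp [μ.eq_zero ω hω]
    rw [e1] at h1
    refine le_trans ?_ h1
    rw [← Finset.sum_indicator_subset (fun R => μ.rectMass R ^ 2) (subset_univ (rectsIn E))]
    refine Finset.sum_le_sum fun p _ => ?_
    by_cases hp : p ∈ D
    · have hpE : p ∈ rectsIn E := by
        -- A node of `D` is covered by the boundary squares below it, and these lie in `D` because
        -- it is a lower set.
        refine mem_filter.2 ⟨mem_univ _, fun x hx => ?_⟩
        obtain ⟨ω, hω, hωp, hxω⟩ := exists_boundary_le (α := (p : BiTree N)) hx
        have hωD : ω ∈ D := hD (Prod.le_def.2 (le_iff_prod.1 hωp)) hp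
        exact Set.mem_iUnion₂.2 ⟨ω, mem_filter.2 ⟨hω, hωD⟩, hxω⟩
      refine le_of_eq ((Set.indicator_of_mem hp _).trans (Eq.trans ?_
        (Set.indicator_of_mem (mem_coe.2 hpE) fun R => μ.rectMass R ^ 2).symm))
      exact congrArg (· ^ 2) ((rectMass_eq_hardyDual μ p).trans (hardyDual_eq_downSum _ p)).symm
    · rw [Set.indicator_of_notMem hp]
      exact Set.indicator_nonneg (fun _ _ => sq_nonneg _) _
  have hH := restrictedEnergy_of_carleson DyadicTree.isForest DyadicTree.isForest μ.nonneg hlow hC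
  intro ψ
  have h2 := energy_mul_le_of_restrictedEnergy DyadicTree.isForest DyadicTree.isForest μ.nonneg
    (by positivity) hH (ψ := fun p => |ψ p|) fun p => abs_nonneg _
  rw [sum_boundary_mul μ fun ω => |ψ ω| ^ 2]
  calc ∑ α, |hardyDual (fun β => ψ β * μ.mass β) α| ^ 2
      ≤ ∑ α, hardyDual (fun β => |ψ β| * μ.mass β) α ^ 2 := by
        refine Finset.sum_le_sum fun α _ => pow_le_pow_left₀ (abs_nonneg _) ?_ 2
        refine (abs_hardyDual_le _ α).trans (le_of_eq ?_)
        simp only [abs_mul, abs_of_nonneg (μ.nonneg _)]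
    _ = energy (P := DyadicTree N × DyadicTree N) fun p => |ψ p| * μ.mass p := by
        simp only [hardyDual_eq_downSum]
        rfl
    _ ≤ 6144 * (32768 * C) * ∑ ω, |ψ ω| ^ 2 * μ.mass ω := h2
    _ = 201326592 * C * ∑ ω, |ψ ω| ^ 2 * μ.mass ω := by ring

end BoundaryMeasure

theorem theorem1p1 :
    -- one constant `K`, independent of the depth `N`, of the measure and of the constant `C`
    (∃ K : ℝ, 0 < K ∧ ∀ (N : ℕ) (μ : BoundaryMeasure N) (C : ℝ), 0 ≤ C →
      ∀ P ∈ ([μ.IsCarleson, μ.IsHereditaryCarleson, μ.IsEmbedding, μ.IsDualEmbedding] :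
          List (ℝ → Prop)),
        ∀ Q ∈ ([μ.IsCarleson, μ.IsHereditaryCarleson, μ.IsEmbedding, μ.IsDualEmbedding] :
          List (ℝ → Prop)),
          P C → Q (K * C)) ∧
    -- the two embeddings hold with the same constant
    (∀ (N : ℕ) (μ : BoundaryMeasure N) (C : ℝ), 0 ≤ C →
      (μ.IsEmbedding C ↔ μ.IsDualEmbedding C)) := by
  refine ⟨⟨201326592, by norm_num, fun N μ C hC P hP Q hQ h => ?_⟩, fun N μ C hC =>
    ⟨fun h => h.isDualEmbedding hC, fun h => h.isEmbedding hC⟩⟩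
  have hK : C ≤ 201326592 * C := by linarith
  have hKC : 0 ≤ 201326592 * C := by linarith
  -- Every implication passes through the second embedding; the constant is `6144 · 32768`.
  have hdual : μ.IsDualEmbedding (201326592 * C) := by
    simp only [List.mem_cons, List.not_mem_nil, or_false] at hP
    rcases hP with rfl | rfl | rfl | rfl
    · exact h.isDualEmbedding hC
    · exact h.isCarleson.isDualEmbedding hC
    · exact (h.isDualEmbedding hC).mono hK
    · exact h.mono hK
  simp only [List.mem_cons, List.not_mem_nil, or_false] at hQ
  rcases hQ with rfl | rfl | rfl | rfl
  · exact hdual.isCarleson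
  · exact hdual.isHereditaryCarleson
  · exact hdual.isEmbedding hKC
  · exact hdual
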